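/- Let $p\in(0,1/2)$ and let $\Omega\subset\mathbb{R}^2$ be an unbounded open convex set with $\Omega\neq\mathbb{R}^2$. Then there is no function $u\in C^2(\Omega)$ that is positive and convex on $\Omega$, solves $$\det D^2u=u^p\quad\text{in }\Omega,$$ and is Euclidean complete. Here a solution on $\Omega$ is called Euclidean complete if $\Omega$ is the whole space or if, in case $\Omega\ne\mathbb{R}^2$, it satisfies the large condition $\lim_{x\to\partial\Omega}u(x)=\infty$, that is, $u(x)\to\infty$ as $x\in\Omega$ tends to $z$, for every $z\in\partial\Omega$. -/

import Mathlib

open Set Filter Topology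

/-- The Hessian matrix `D²u(x)` of a function on `ℝⁿ`: its `(i, j)` entry is the second partial
derivative of `u` at `x` in the coordinate directions `i` and `j`. -/
noncomputable def hessianMatrix {n : ℕ} (u : EuclideanSpace ℝ (Fin n) → ℝ)
    (x : EuclideanSpace ℝ (Fin n)) : Matrix (Fin n) (Fin n) ℝ :=
  Matrix.of fun i j =>
    fderiv ℝ (fderiv ℝ u) x (EuclideanSpace.single i 1) (EuclideanSpace.single j 1)

/-- `u` is a positive convex (classical, i.e. `C²`) solution of `det D²u = u^p` on `Ω`.
Only the values of `u` on `Ω` matter when `Ω` is open. -/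
structure IsPositiveConvexSolution {n : ℕ} (p : ℝ) (Ω : Set (EuclideanSpace ℝ (Fin n)))
    (u : EuclideanSpace ℝ (Fin n) → ℝ) : Prop where
  contDiffOn : ContDiffOn ℝ 2 u Ω
  convexOn : ConvexOn ℝ Ω u
  pos : ∀ x ∈ Ω, 0 < u x
  equation : ∀ x ∈ Ω, (hessianMatrix u x).det = u x ^ p

/-- The large condition: `u(x) → ∞` as `x ∈ Ω` tends to any (finite) boundary point of `Ω`. -/
def IsLarge {n : ℕ} (Ω : Set (EuclideanSpace ℝ (Fin n)))
    (u : EuclideanSpace ℝ (Fin n) → ℝ) : Prop :=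
  ∀ z ∈ frontier Ω, Tendsto u (𝓝[Ω] z) atTop

/-- Euclidean completeness of a function on `Ω`: it is entire (`Ω` is the whole space), or
`Ω` is not the whole space and the function is large. -/
def IsEuclideanComplete {n : ℕ} (Ω : Set (EuclideanSpace ℝ (Fin n)))
    (u : EuclideanSpace ℝ (Fin n) → ℝ) : Prop :=
  Ω = univ ∨ (Ω ≠ univ ∧ IsLarge Ω u)

/-! For 0 < p < 2 a solution cannot blow up at finite distance. Write S_t = {u ≤ t}. At a touching
point the order of Hessians gives the order of determinants, so u can be compared with explicit
barriers.

A large triangle in S_t would carry a supersolution, a power of a quadratic, forcing u to be too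
small at the centroid. Hence squared areas are at most a constant times t^(2-p)
(`sq_planeCross_le`), and for a large solution S_t is compact once it has interior. The area bound
in turn places a square-root subsolution below u, which keeps S_{t/2} away from each supporting line
of S_t by a fraction δ of the width, with δ depending only on p (`support_gap`).

Since Ω is convex and not the plane, some nonzero linear l is bounded below on Ω. Each doubling of t
lowers the minimum of l over S_t by at least δ times a fixed width, so these minima tend to -∞, a
contradiction (`not_isLarge`). -/

/-! ### Second differences at touching points -/

/-- The symmetric second derivative of `f` at `z` in the direction `e` equals `q`. -/
def HasSymmSndDeriv {E : Type*} [AddCommGroup E] [Module ℝ E] (f : E → ℝ) (z e : E) (q : ℝ) :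
    Prop :=
  Tendsto (fun t : ℝ => (f (z + t • e) + f (z + (-t) • e) - 2 * f z) / t ^ 2) (𝓝[≠] 0) (𝓝 q)

/-- One use of L'Hôpital leaves the mean of the slopes of `g'` at t and -t, so `g'` need only be
differentiable at 0. -/
theorem tendsto_symm_second_difference {g g' : ℝ → ℝ} {q : ℝ}
    (h : ∀ᶠ t in 𝓝 0, HasDerivAt g (g' t) t) (h' : HasDerivAt g' q 0) :
    Tendsto (fun t => (g t + g (-t) - 2 * g 0) / t ^ 2) (𝓝[≠] 0) (𝓝 q) := by
  have hneg : Tendsto (fun t : ℝ => -t) (𝓝 0) (𝓝 0) := by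
    simpa using (continuous_neg (G := ℝ)).tendsto 0
  have hneg' : Tendsto (fun t : ℝ => -t) (𝓝[≠] 0) (𝓝[≠] 0) :=
    tendsto_nhdsWithin_of_tendsto_nhds_of_eventually_within _
      (hneg.mono_left nhdsWithin_le_nhds)
      (eventually_mem_nhdsWithin.mono fun t ht => by simpa using ht)
  have hcont : ContinuousAt g 0 := h.self_of_nhds.continuousAt
  have hs := h'.tendsto_slope
  refine HasDerivAt.lhopital_zero_nhdsNE
    (f' := fun t => g' t - g' (-t)) (g' := fun t => 2 * t) ?_ ?_ ?_ ?_ ?_ ?_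
  · filter_upwards [h.filter_mono nhdsWithin_le_nhds,
      (hneg.eventually h).filter_mono nhdsWithin_le_nhds] with t h1 h2
    have := (h1.add (h2.comp t (hasDerivAt_neg t))).sub_const (2 * g 0)
    simpa [Function.comp_def, sub_eq_add_neg] using this
  · exact Eventually.of_forall fun t => by simpa using hasDerivAt_pow 2 t
  · filter_upwards [eventually_mem_nhdsWithin] with t ht
    simpa using ht
  · have : Tendsto (fun t => g t + g (-t) - 2 * g 0) (𝓝 0) (𝓝 (g 0 + g 0 - 2 * g 0)) :=
      (hcont.tendsto.add (hcont.tendsto.comp hneg)).sub_const _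
    rw [show g 0 + g 0 - 2 * g 0 = 0 by ring] at this
    exact this.mono_left nhdsWithin_le_nhds
  · have : Tendsto (fun t : ℝ => t ^ 2) (𝓝 0) (𝓝 (0 ^ 2)) := (continuous_pow 2).tendsto 0
    simpa using this.mono_left nhdsWithin_le_nhds
  · have := (hs.add (hs.comp hneg')).div_const 2
    rw [show (q + q) / 2 = q by ring] at this
    refine this.congr' ?_
    filter_upwards [eventually_mem_nhdsWithin] with t ht
    have ht : t ≠ 0 := by simpa using ht
    simp only [slope, Function.comp, vsub_eq_sub, smul_eq_mul, sub_zero]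
    field_simp
    ring

section touching

variable {E : Type*} [AddCommGroup E] [Module ℝ E]

theorem HasSymmSndDeriv.of_hasDerivAt {f : E → ℝ} {z e : E} {g' : ℝ → ℝ} {q : ℝ}
    (h : ∀ᶠ t in 𝓝 (0 : ℝ), HasDerivAt (fun t : ℝ => f (z + t • e)) (g' t) t)
    (h' : HasDerivAt g' q 0) : HasSymmSndDeriv f z e q := by
  simpa [HasSymmSndDeriv] using tendsto_symm_second_difference h h'

theorem HasSymmSndDeriv.le_of_isLocalMax_sub [TopologicalSpace E] [ContinuousAdd E]
    [ContinuousSMul ℝ E] {f g : E → ℝ} {z e : E} {a b : ℝ}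
    (hf : HasSymmSndDeriv f z e a) (hg : HasSymmSndDeriv g z e b)
    (h : IsLocalMax (fun x => f x - g x) z) : a ≤ b := by
  refine le_of_tendsto_of_tendsto hf hg ?_
  have h1 : Tendsto (fun t : ℝ => z + t • e) (𝓝 0) (𝓝 z) := by
    have : Continuous fun t : ℝ => z + t • e := by fun_prop
    simpa using this.tendsto 0
  have h2 : Tendsto (fun t : ℝ => z + (-t) • e) (𝓝 0) (𝓝 z) := by
    have : Continuous fun t : ℝ => z + (-t) • e := by fun_prop
    simpa using this.tendsto 0
  filter_upwards [(h1.eventually h).filter_mono nhdsWithin_le_nhds,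
    (h2.eventually h).filter_mono nhdsWithin_le_nhds] with t ht1 ht2
  gcongr ?_ / _
  linarith

end touching

/-! ### Determinants of ordered quadratic forms -/

theorem mul_sub_sq_nonneg_of_forall_quadratic_nonneg {a b c : ℝ}
    (h : ∀ x y : ℝ, 0 ≤ a * x ^ 2 + 2 * b * (x * y) + c * y ^ 2) :
    0 ≤ a ∧ 0 ≤ c ∧ 0 ≤ a * c - b ^ 2 := by
  have ha : 0 ≤ a := by simpa using h 1 0
  have hc : 0 ≤ c := by simpa using h 0 1
  refine ⟨ha, hc, ?_⟩
  rcases ha.eq_or_lt with rfl | ha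
  · rcases hc.eq_or_lt with rfl | hc
    · have h1 := h 1 1
      have h2 := h 1 (-1)
      have : b = 0 := by linarith
      simp [this]
    · have := h c (-b)
      nlinarith
  · have := h b (-a)
    have h3 : 0 ≤ a * (a * c - b ^ 2) := by nlinarith
    exact nonneg_of_mul_nonneg_right h3 ha

/-- The determinant of a sum of two semidefinite forms is the sum of their determinants plus a mixed
term, which is nonnegative by AM-GM (`key`). -/
theorem mul_sub_sq_le_of_forall_quadratic_le {a b c A B C : ℝ}
    (h0 : ∀ x y : ℝ, 0 ≤ a * x ^ 2 + 2 * b * (x * y) + c * y ^ 2)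
    (h : ∀ x y : ℝ, a * x ^ 2 + 2 * b * (x * y) + c * y ^ 2 ≤
      A * x ^ 2 + 2 * B * (x * y) + C * y ^ 2) :
    a * c - b ^ 2 ≤ A * C - B ^ 2 := by
  obtain ⟨ha, hc, hd⟩ := mul_sub_sq_nonneg_of_forall_quadratic_nonneg h0
  obtain ⟨ha', hc', hd'⟩ := mul_sub_sq_nonneg_of_forall_quadratic_nonneg
    (a := A - a) (b := B - b) (c := C - c) fun x y => by linarith [h x y]
  have key : 2 * (b * (B - b)) ≤ a * (C - c) + (A - a) * c := by
    have h1 : b ^ 2 * (B - b) ^ 2 ≤ (a * c) * ((A - a) * (C - c)) :=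
      mul_le_mul (by linarith) (by linarith) (sq_nonneg _) (mul_nonneg ha hc)
    refine (abs_le_of_sq_le_sq' ?_ (by positivity)).2
    nlinarith [sq_nonneg (a * (C - c) - (A - a) * c)]
  nlinarith

theorem hessian_det_fin_two_eq (u : EuclideanSpace ℝ (Fin 2) → ℝ) (x : EuclideanSpace ℝ (Fin 2)) :
    (hessianMatrix u x).det = hessianMatrix u x 0 0 * hessianMatrix u x 1 1 -
      hessianMatrix u x 0 1 * hessianMatrix u x 1 0 := Matrix.det_fin_two _

theorem euclidean_fin_two_eq (e : EuclideanSpace ℝ (Fin 2)) :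
    e = e 0 • EuclideanSpace.single 0 1 + e 1 • EuclideanSpace.single 1 1 := by
  ext i; fin_cases i <;> simp

/-! ### Testing the equation by touching functions -/

namespace IsPositiveConvexSolution

variable {p : ℝ} {Ω : Set (EuclideanSpace ℝ (Fin 2))} {u : EuclideanSpace ℝ (Fin 2) → ℝ}

/-- Extracts all that comparison needs from the equation; semidefiniteness comes from midpoint
convexity along lines. -/
theorem exists_hasSymmSndDeriv (hu : IsPositiveConvexSolution p Ω u) (hΩ : IsOpen Ω)
    {z : EuclideanSpace ℝ (Fin 2)} (hz : z ∈ Ω) :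
    ∃ a b c : ℝ, a * c - b ^ 2 = u z ^ p ∧
      (∀ x y : ℝ, 0 ≤ a * x ^ 2 + 2 * b * (x * y) + c * y ^ 2) ∧
      ∀ e, HasSymmSndDeriv u z e (a * e 0 ^ 2 + 2 * b * (e 0 * e 1) + c * e 1 ^ 2) := by
  have hC : ContDiffAt ℝ 2 u z := hu.contDiffOn.contDiffAt (hΩ.mem_nhds hz)
  have hsymm : hessianMatrix u z 1 0 = hessianMatrix u z 0 1 :=
    (hC.isSymmSndFDerivAt (by simp)).eq _ _
  have hev : ∀ᶠ x in 𝓝 z, DifferentiableAt ℝ u x := by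
    filter_upwards [hΩ.mem_nhds hz] with x hx
    exact (hu.contDiffOn.contDiffAt (hΩ.mem_nhds hx)).differentiableAt (by simp)
  have hdd : DifferentiableAt ℝ (fderiv ℝ u) z :=
    (hC.fderiv_right (m := 1) (by norm_num)).differentiableAt (by simp)
  have hq : ∀ e, HasSymmSndDeriv u z e (hessianMatrix u z 0 0 * e 0 ^ 2 +
      2 * hessianMatrix u z 0 1 * (e 0 * e 1) + hessianMatrix u z 1 1 * e 1 ^ 2) := by
    intro e
    have hline : ∀ t : ℝ, HasDerivAt (fun t : ℝ => z + t • e) e t := fun t => by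
      simpa using ((hasDerivAt_id t).smul_const e).const_add z
    have hval : fderiv ℝ (fderiv ℝ u) z e e = hessianMatrix u z 0 0 * e 0 ^ 2 +
        2 * hessianMatrix u z 0 1 * (e 0 * e 1) + hessianMatrix u z 1 1 * e 1 ^ 2 := by
      have hsymm' := hsymm
      simp only [hessianMatrix, Matrix.of_apply] at hsymm' ⊢
      conv_lhs => rw [euclidean_fin_two_eq e]
      simp only [map_add, map_smul, add_apply, smul_apply,
        smul_eq_mul, hsymm']
      ring
    rw [← hval]
    have ht : Tendsto (fun t : ℝ => z + t • e) (𝓝 0) (𝓝 z) := by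
      simpa using (hline 0).continuousAt.tendsto
    refine HasSymmSndDeriv.of_hasDerivAt (g' := fun t => fderiv ℝ u (z + t • e) e) ?_ ?_
    · filter_upwards [ht.eventually hev] with t h
      exact h.hasFDerivAt.comp_hasDerivAt t (hline t)
    · have h1 : HasFDerivAt (fderiv ℝ u) (fderiv ℝ (fderiv ℝ u) z) (z + (0 : ℝ) • e) := by
        simpa using hdd.hasFDerivAt
      have := h1.comp_hasDerivAt (0 : ℝ) (hline 0)
      simpa using this.clm_apply (hasDerivAt_const (0 : ℝ) e)
  refine ⟨_, _, _, ?_, ?_, hq⟩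
  · rw [← hu.equation z hz, hessian_det_fin_two_eq, hsymm]; ring
  · intro x y
    have := hq !₂[x, y]
    simp only [Matrix.cons_val_zero, Matrix.cons_val_one] at this
    refine ge_of_tendsto this ?_
    have hmem : ∀ s : ℝ → ℝ, Continuous s → s 0 = 0 →
        ∀ᶠ t in 𝓝[≠] (0 : ℝ), z + s t • !₂[x, y] ∈ Ω := by
      intro s hs h0
      have hc : Continuous fun t : ℝ => z + s t • !₂[x, y] := by fun_prop
      have := hc.tendsto 0
      simp only [h0, zero_smul, add_zero] at this
      exact (this.eventually (hΩ.mem_nhds hz)).filter_mono nhdsWithin_le_nhds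
    filter_upwards [hmem (fun t => t) continuous_id rfl,
      hmem (fun t => -t) continuous_neg neg_zero] with t h1 h2
    have := hu.convexOn.2 h1 h2 (show (0 : ℝ) ≤ 1 / 2 by norm_num)
      (show (0 : ℝ) ≤ 1 / 2 by norm_num) (by norm_num)
    rw [show (1 / 2 : ℝ) • (z + t • !₂[x, y]) + (1 / 2 : ℝ) • (z + -t • !₂[x, y]) = z by
      module] at this
    simp only [smul_eq_mul] at this
    apply div_nonneg _ (sq_nonneg t)
    linarith

/-- A test function of two affine coordinates touching a solution from above. -/
theorem rpow_le_of_isLocalMax_sub (hu : IsPositiveConvexSolution p Ω u) (hΩ : IsOpen Ω)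
    {z : EuclideanSpace ℝ (Fin 2)} (hz : z ∈ Ω) {φ : EuclideanSpace ℝ (Fin 2) → ℝ}
    {X₀ X₁ Y₀ Y₁ A B C : ℝ} (hmax : IsLocalMax (fun x => u x - φ x) z)
    (hφ : ∀ e, HasSymmSndDeriv φ z e (A * (X₀ * e 0 + X₁ * e 1) ^ 2 +
      2 * B * ((X₀ * e 0 + X₁ * e 1) * (Y₀ * e 0 + Y₁ * e 1)) + C * (Y₀ * e 0 + Y₁ * e 1) ^ 2)) :
    u z ^ p ≤ (A * C - B ^ 2) * (X₀ * Y₁ - X₁ * Y₀) ^ 2 := by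
  obtain ⟨a, b, c, hdet, hpsd, hq⟩ := hu.exists_hasSymmSndDeriv hΩ hz
  rw [← hdet]
  have := mul_sub_sq_le_of_forall_quadratic_le hpsd
    (A := A * X₀ ^ 2 + 2 * B * (X₀ * Y₀) + C * Y₀ ^ 2)
    (B := A * (X₀ * X₁) + B * (X₀ * Y₁ + X₁ * Y₀) + C * (Y₀ * Y₁))
    (C := A * X₁ ^ 2 + 2 * B * (X₁ * Y₁) + C * Y₁ ^ 2) fun x y => by
      have := (hq !₂[x, y]).le_of_isLocalMax_sub (hφ _) hmax
      simp only [Matrix.cons_val_zero, Matrix.cons_val_one] at this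
      linarith
  linarith

/-- A convex test function of two affine coordinates touching a solution from below. -/
theorem le_rpow_of_isLocalMin_sub (hu : IsPositiveConvexSolution p Ω u) (hΩ : IsOpen Ω)
    {z : EuclideanSpace ℝ (Fin 2)} (hz : z ∈ Ω) {φ : EuclideanSpace ℝ (Fin 2) → ℝ}
    {X₀ X₁ Y₀ Y₁ A B C : ℝ} (hmin : IsLocalMin (fun x => u x - φ x) z)
    (hφ : ∀ e, HasSymmSndDeriv φ z e (A * (X₀ * e 0 + X₁ * e 1) ^ 2 +
      2 * B * ((X₀ * e 0 + X₁ * e 1) * (Y₀ * e 0 + Y₁ * e 1)) + C * (Y₀ * e 0 + Y₁ * e 1) ^ 2))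
    (hA : 0 < A) (hD : 0 ≤ A * C - B ^ 2) :
    (A * C - B ^ 2) * (X₀ * Y₁ - X₁ * Y₀) ^ 2 ≤ u z ^ p := by
  obtain ⟨a, b, c, hdet, hpsd, hq⟩ := hu.exists_hasSymmSndDeriv hΩ hz
  rw [← hdet]
  have hpos : ∀ x y : ℝ, 0 ≤ A * x ^ 2 + 2 * B * (x * y) + C * y ^ 2 := fun x y => by
    have : 0 ≤ A * (A * x ^ 2 + 2 * B * (x * y) + C * y ^ 2) := by
      have h1 := mul_nonneg hD (sq_nonneg y)
      nlinarith [sq_nonneg (A * x + B * y)]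
    exact nonneg_of_mul_nonneg_right this hA
  have hmax : IsLocalMax (fun x => φ x - u x) z := by
    simpa [neg_sub] using IsLocalMin.neg hmin
  have := mul_sub_sq_le_of_forall_quadratic_le
    (a := A * X₀ ^ 2 + 2 * B * (X₀ * Y₀) + C * Y₀ ^ 2)
    (b := A * (X₀ * X₁) + B * (X₀ * Y₁ + X₁ * Y₀) + C * (Y₀ * Y₁))
    (c := A * X₁ ^ 2 + 2 * B * (X₁ * Y₁) + C * Y₁ ^ 2) (A := a) (B := b) (C := c)
    (fun x y => by linarith [hpos (X₀ * x + X₁ * y) (Y₀ * x + Y₁ * y)]) fun x y => by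
      have := (hφ !₂[x, y]).le_of_isLocalMax_sub (hq _) hmax
      simp only [Matrix.cons_val_zero, Matrix.cons_val_one] at this
      linarith
  linarith

end IsPositiveConvexSolution

/-! ### Hessians of the two barriers -/

theorem hasSymmSndDeriv_rpow_barrier {X Y : EuclideanSpace ℝ (Fin 2) → ℝ} {X₀ X₁ Y₀ Y₁ : ℝ}
    (hX : ∀ v e (t : ℝ), X (v + t • e) = X v + t * (X₀ * e 0 + X₁ * e 1))
    (hY : ∀ v e (t : ℝ), Y (v + t • e) = Y v + t * (Y₀ * e 0 + Y₁ * e 1))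
    (M s : ℝ) {ε : ℝ} (hε : 0 < ε) (z e : EuclideanSpace ℝ (Fin 2)) :
    HasSymmSndDeriv (fun v => M * (X v ^ 2 + Y v ^ 2 + ε) ^ s) z e
      ((4 * M * s * (s - 1) * (X z ^ 2 + Y z ^ 2 + ε) ^ (s - 2) * X z ^ 2 +
          2 * M * s * (X z ^ 2 + Y z ^ 2 + ε) ^ (s - 1)) * (X₀ * e 0 + X₁ * e 1) ^ 2 +
        2 * (4 * M * s * (s - 1) * (X z ^ 2 + Y z ^ 2 + ε) ^ (s - 2) * (X z * Y z)) *
          ((X₀ * e 0 + X₁ * e 1) * (Y₀ * e 0 + Y₁ * e 1)) +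
        (4 * M * s * (s - 1) * (X z ^ 2 + Y z ^ 2 + ε) ^ (s - 2) * Y z ^ 2 +
          2 * M * s * (X z ^ 2 + Y z ^ 2 + ε) ^ (s - 1)) * (Y₀ * e 0 + Y₁ * e 1) ^ 2) := by
  set ξ := X₀ * e 0 + X₁ * e 1
  set η := Y₀ * e 0 + Y₁ * e 1
  have hlin : ∀ a b t : ℝ, HasDerivAt (fun t => a + t * b) b t := fun a b t => by
    simpa using ((hasDerivAt_id t).mul_const b).const_add a
  have hρ : ∀ t : ℝ, HasDerivAt (fun t => (X z + t * ξ) ^ 2 + (Y z + t * η) ^ 2 + ε)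
      (2 * (X z + t * ξ) * ξ + 2 * (Y z + t * η) * η) t := fun t => by
    simpa using (((hlin (X z) ξ t).pow 2).add ((hlin (Y z) η t).pow 2)).add_const ε
  have hρ' : ∀ t : ℝ, HasDerivAt (fun t => 2 * (X z + t * ξ) * ξ + 2 * (Y z + t * η) * η)
      (2 * ξ * ξ + 2 * η * η) t := fun t =>
    (((hlin (X z) ξ t).const_mul 2).mul_const ξ).add (((hlin (Y z) η t).const_mul 2).mul_const η)
  have hne : ∀ t : ℝ, (X z + t * ξ) ^ 2 + (Y z + t * η) ^ 2 + ε ≠ 0 := fun t => by positivity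
  refine HasSymmSndDeriv.of_hasDerivAt (g' := fun t => M *
    ((2 * (X z + t * ξ) * ξ + 2 * (Y z + t * η) * η) * s *
      ((X z + t * ξ) ^ 2 + (Y z + t * η) ^ 2 + ε) ^ (s - 1))) ?_ ?_
  · refine Eventually.of_forall fun t => ?_
    simp only [hX, hY]
    exact ((hρ t).rpow_const (Or.inl (hne t))).const_mul M
  · have h := ((((hρ' 0).mul_const s).mul
      ((hρ 0).rpow_const (p := s - 1) (Or.inl (hne 0)))).const_mul M)
    simp only [zero_mul, add_zero] at h
    refine h.congr_deriv ?_
    rw [show s - 1 - 1 = s - 2 by ring]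
    ring

/-- The root gives infinite slope at the line X = 0, and the factor 4 - Y² adds convexity in the Y
direction. -/
theorem hasSymmSndDeriv_sqrt_barrier {X Y : EuclideanSpace ℝ (Fin 2) → ℝ} {X₀ X₁ Y₀ Y₁ : ℝ}
    (hX : ∀ v e (t : ℝ), X (v + t • e) = X v + t * (X₀ * e 0 + X₁ * e 1))
    (hY : ∀ v e (t : ℝ), Y (v + t • e) = Y v + t * (Y₀ * e 0 + Y₁ * e 1))
    (k b : ℝ) {z : EuclideanSpace ℝ (Fin 2)} (hz : 0 < X z) (e : EuclideanSpace ℝ (Fin 2)) :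
    HasSymmSndDeriv (fun v => k - b * (√(X v) * (4 - Y v ^ 2))) z e
      (b * (4 - Y z ^ 2) / (4 * X z * √(X z)) * (X₀ * e 0 + X₁ * e 1) ^ 2 +
        2 * (b * Y z / √(X z)) * ((X₀ * e 0 + X₁ * e 1) * (Y₀ * e 0 + Y₁ * e 1)) +
        2 * b * √(X z) * (Y₀ * e 0 + Y₁ * e 1) ^ 2) := by
  set ξ := X₀ * e 0 + X₁ * e 1
  set η := Y₀ * e 0 + Y₁ * e 1
  have hlin : ∀ a b t : ℝ, HasDerivAt (fun t => a + t * b) b t := fun a b t => by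
    simpa using ((hasDerivAt_id t).mul_const b).const_add a
  have hpos : ∀ᶠ t : ℝ in 𝓝 0, 0 < X z + t * ξ :=
    (hlin (X z) ξ 0).continuousAt.eventually_const_lt (by simpa using hz)
  have hsqrt : ∀ t, 0 < X z + t * ξ →
      HasDerivAt (fun t => √(X z + t * ξ)) (ξ / (2 * √(X z + t * ξ))) t := fun t ht =>
    (hlin (X z) ξ t).sqrt ht.ne'
  have hquad : ∀ t, HasDerivAt (fun t => 4 - (Y z + t * η) ^ 2) (-(2 * (Y z + t * η) * η)) t :=
    fun t => by simpa using ((hlin (Y z) η t).pow 2).const_sub 4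
  refine HasSymmSndDeriv.of_hasDerivAt (g' := fun t => -(b *
    (ξ / (2 * √(X z + t * ξ)) * (4 - (Y z + t * η) ^ 2) +
      √(X z + t * ξ) * -(2 * (Y z + t * η) * η)))) ?_ ?_
  · filter_upwards [hpos] with t ht
    simp only [hX, hY]
    exact (((hsqrt t ht).mul (hquad t)).const_mul b).const_sub k
  · have h0 : 0 < X z + 0 * ξ := by simpa using hz
    have hs : 0 < √(X z) := Real.sqrt_pos.2 hz
    have h1 := ((hasDerivAt_const (0 : ℝ) ξ).div ((hsqrt 0 h0).const_mul 2)
      (by simpa using hs.ne')).mul (hquad 0)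
    have h2 := (hsqrt 0 h0).mul ((((hlin (Y z) η 0).const_mul 2).mul_const η).neg)
    have h := ((h1.add h2).const_mul b).neg
    refine h.congr_deriv ?_
    simp only [Pi.div_apply, Pi.neg_apply, zero_mul, add_zero]
    have hsq : X z = √(X z) ^ 2 := (Real.sq_sqrt hz.le).symm
    generalize √(X z) = r at hs hsq ⊢
    rw [hsq]
    field_simp
    ring

/-! ### Area of triangles in a sublevel set -/

/-- The determinant of two plane vectors. -/
def planeCross (v w : EuclideanSpace ℝ (Fin 2)) : ℝ := v 0 * w 1 - v 1 * w 0

theorem planeCross_smul_eq (P Q R x : EuclideanSpace ℝ (Fin 2)) :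
    planeCross (Q - P) (R - P) • x =
      (planeCross (Q - P) (R - P) - planeCross (x - P) (R - P) - planeCross (Q - P) (x - P)) • P +
        planeCross (x - P) (R - P) • Q + planeCross (Q - P) (x - P) • R := by
  ext i; fin_cases i <;> simp [planeCross] <;> ring

/-- The constant in the area bound for triangles in a sublevel set. -/
noncomputable def triangleConst (p : ℝ) : ℝ :=
  4 * (2 / (2 - p)) ^ 2 * (2 * (2 / (2 - p)) - 1) * 36 ^ 2

theorem triangleConst_pos {p : ℝ} (hp : 0 < p) (hp2 : p < 2) : 0 < triangleConst p := by
  have h1 : 0 < 2 - p := by linarith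
  have h2 : 0 < 2 * (2 / (2 - p)) - 1 := by
    rw [sub_pos, ← mul_div_assoc, lt_div_iff₀ h1]; linarith
  rw [triangleConst]; positivity

namespace IsPositiveConvexSolution

variable {p : ℝ} {Ω : Set (EuclideanSpace ℝ (Fin 2))} {u : EuclideanSpace ℝ (Fin 2) → ℝ}

/-- The exponent s = 2/(2-p) satisfies sp = 2(s-1), so φ^p and the bound for det D²φ are the same
power of X² + Y² + ε. The affine change of variables divides the determinant by J², so a large J
makes φ a supersolution. -/
theorem sq_planeCross_le (hu : IsPositiveConvexSolution p Ω u) (hΩ : IsOpen Ω)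
    (hp : 0 < p) (hp2 : p < 2) {t : ℝ} {P Q R : EuclideanSpace ℝ (Fin 2)}
    (hP : P ∈ Ω) (hQ : Q ∈ Ω) (hR : R ∈ Ω) (huP : u P ≤ t) (huQ : u Q ≤ t) (huR : u R ≤ t) :
    planeCross (Q - P) (R - P) ^ 2 ≤ triangleConst p * t ^ (2 - p) := by
  by_contra! hJ
  have ht : 0 < t := (hu.pos P hP).trans_le huP
  set J := planeCross (Q - P) (R - P) with hJdef
  set s := 2 / (2 - p) with hs
  have hs1 : 1 < s := by rw [hs, lt_div_iff₀ (by linarith)]; linarith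
  have hsp : s * (2 - p) = 2 := by rw [hs]; field_simp [show 2 - p ≠ 0 by linarith]
  have hJ0 : J ≠ 0 := by
    intro h0
    have := mul_pos (triangleConst_pos hp hp2) (Real.rpow_pos_of_pos ht (2 - p))
    rw [h0] at hJ; linarith
  let X : EuclideanSpace ℝ (Fin 2) → ℝ := fun x => planeCross (x - P) (R - P) / J - 1 / 3
  let Y : EuclideanSpace ℝ (Fin 2) → ℝ := fun x => planeCross (Q - P) (x - P) / J - 1 / 3
  have hXc : Continuous X := by unfold X planeCross; fun_prop
  have hYc : Continuous Y := by unfold Y planeCross; fun_prop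
  have hX : ∀ v e (r : ℝ), X (v + r • e) = X v +
      r * ((R - P) 1 / J * e 0 + (-(R - P) 0 / J) * e 1) := fun v e r => by
    simp [X, planeCross]; ring
  have hY : ∀ v e (r : ℝ), Y (v + r • e) = Y v +
      r * ((-(Q - P) 1 / J) * e 0 + (Q - P) 0 / J * e 1) := fun v e r => by
    simp [Y, planeCross]; ring
  have hdet : ((R - P) 1 / J) * ((Q - P) 0 / J) - (-(R - P) 0 / J) * (-(Q - P) 1 / J) = 1 / J := by
    rw [show (R - P) 1 / J * ((Q - P) 0 / J) - (-(R - P) 0 / J) * (-(Q - P) 1 / J) =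
      J / J / J by rw [hJdef]; simp only [planeCross]; ring, div_self hJ0]
  -- A disc of radius 1/6 about the centroid in affine coordinates: barycentric coordinates stay
  -- nonnegative there.
  let D : Set (EuclideanSpace ℝ (Fin 2)) := {x | X x ^ 2 + Y x ^ 2 ≤ 1 / 36}
  have hsub : ∀ x ∈ D, x ∈ convexHull ℝ {P, Q, R} ∧ x ∈ Ω ∧ u x ≤ t := by
    intro x hx
    have hX6 : |X x| ≤ 1 / 6 := abs_le_of_sq_le_sq (by nlinarith [sq_nonneg (Y x), hx.out])
      (by norm_num)
    have hY6 : |Y x| ≤ 1 / 6 := abs_le_of_sq_le_sq (by nlinarith [sq_nonneg (X x), hx.out])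
      (by norm_num)
    rw [abs_le] at hX6 hY6
    have hx' : x = (1 - (X x + 1 / 3) - (Y x + 1 / 3)) • P + (X x + 1 / 3) • Q +
        (Y x + 1 / 3) • R := by
      have := congrArg (fun w => J⁻¹ • w) (planeCross_smul_eq P Q R x)
      simp only [← hJdef, smul_add, smul_smul, inv_mul_cancel₀ hJ0, one_smul] at this
      rwa [show J⁻¹ * (J - planeCross (x - P) (R - P) - planeCross (Q - P) (x - P)) =
          1 - (X x + 1 / 3) - (Y x + 1 / 3) by simp only [X, Y]; field_simp; ring,
        show J⁻¹ * planeCross (x - P) (R - P) = X x + 1 / 3 by simp only [X]; field_simp; ring,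
        show J⁻¹ * planeCross (Q - P) (x - P) = Y x + 1 / 3 by simp only [Y]; field_simp; ring]
        at this
    have hmem : x ∈ convexHull ℝ {P, Q, R} := by
      have hin : ∀ w ∈ ({P, Q, R} : Set (EuclideanSpace ℝ (Fin 2))), w ∈ convexHull ℝ {P, Q, R} :=
        fun w hw => subset_convexHull ℝ _ hw
      have := (convex_convexHull ℝ {P, Q, R}).sum_mem (t := Finset.univ) (z := ![P, Q, R])
        (w := ![1 - (X x + 1 / 3) - (Y x + 1 / 3), X x + 1 / 3, Y x + 1 / 3])
        (fun i _ => by fin_cases i <;> simp <;> linarith)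
        (by simp only [Fin.sum_univ_three, Matrix.cons_val]; ring)
        (fun i _ => by fin_cases i <;> simp [hin])
      rw [hx']
      simpa [Fin.sum_univ_three] using this
    refine ⟨hmem, ?_⟩
    have : ({P, Q, R} : Set _) ⊆ {x | x ∈ Ω ∧ u x ≤ t} := by
      rintro w (rfl | rfl | rfl) <;> exact ⟨‹_›, ‹_›⟩
    exact convexHull_min this (hu.convexOn.convex_le t) hmem
  have hDc : IsCompact D := by
    refine ((Set.toFinite {P, Q, R}).isCompact_convexHull (𝕜 := ℝ)).of_isClosed_subset ?_
      fun x hx => (hsub x hx).1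
    exact isClosed_le (by fun_prop) continuous_const
  set G : EuclideanSpace ℝ (Fin 2) := (1 / 3 : ℝ) • (P + Q + R) with hG
  have hXG : X G = 0 := by
    have : planeCross (G - P) (R - P) = J / 3 := by
      simp [hG, hJdef, planeCross]; ring
    simp only [X, this]; field_simp; ring
  have hYG : Y G = 0 := by
    have : planeCross (Q - P) (G - P) = J / 3 := by
      simp [hG, hJdef, planeCross]; ring
    simp only [Y, this]; field_simp; ring
  have hGD : G ∈ D := by simp [D, hXG, hYG]
  have huG : 0 < u G := hu.pos G (hsub G hGD).2.1
  -- Makes φ ≥ t ≥ u on the boundary of D, where X² + Y² = 1/36.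
  set M := t * 36 ^ s with hM
  have hM0 : 0 < M := by positivity
  -- Makes φ(G) = u(G)/2, so u - φ has a positive maximum.
  set ε := (u G / (2 * M)) ^ (1 / s) with hε
  have hε0 : 0 < ε := by positivity
  let φ : EuclideanSpace ℝ (Fin 2) → ℝ := fun v => M * (X v ^ 2 + Y v ^ 2 + ε) ^ s
  have hρ : ∀ v, 0 < X v ^ 2 + Y v ^ 2 + ε := fun v => by positivity
  have hφc : Continuous φ := by
    refine continuous_const.mul (Continuous.rpow_const (by fun_prop) fun v => Or.inl (hρ v).ne')
  have huc : ContinuousOn u D := hu.contDiffOn.continuousOn.mono fun x hx => (hsub x hx).2.1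
  obtain ⟨z, hzD, hz⟩ := hDc.exists_isMaxOn ⟨G, hGD⟩ (huc.sub hφc.continuousOn)
  have hzpos : φ z < u z := by
    have h1 : u G - φ G ≤ u z - φ z := hz hGD
    have h2 : φ G = u G / 2 := by
      simp only [φ, hXG, hYG]
      rw [show (0 : ℝ) ^ 2 + 0 ^ 2 + ε = ε by ring, hε, ← Real.rpow_mul (by positivity),
        one_div_mul_cancel (by positivity), Real.rpow_one]
      field_simp
    linarith
  have hzlt : X z ^ 2 + Y z ^ 2 < 1 / 36 := by
    refine lt_of_le_of_ne hzD fun heq => ?_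
    have h1 : t ≤ φ z := by
      simp only [φ, heq, hM]
      have : (1 : ℝ) ≤ 36 ^ s * (1 / 36 + ε) ^ s := by
        rw [← Real.mul_rpow (by norm_num) (by positivity)]
        exact Real.one_le_rpow (by linarith) (by linarith)
      nlinarith
    linarith [(hsub z hzD).2.2]
  have hloc : IsLocalMax (fun x => u x - φ x) z := by
    have hnhds : D ∈ 𝓝 z := by
      filter_upwards [((isOpen_lt (f := fun v => X v ^ 2 + Y v ^ 2) (by fun_prop)
        continuous_const).mem_nhds hzlt : {v | X v ^ 2 + Y v ^ 2 < 1 / 36} ∈ 𝓝 z)] with v hv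
      exact le_of_lt hv
    exact hz.isLocalMax hnhds
  have hle := hu.rpow_le_of_isLocalMax_sub hΩ (hsub z hzD).2.1 hloc
    (hasSymmSndDeriv_rpow_barrier hX hY M s hε0 z)
  rw [hdet] at hle
  have hlt : φ z ^ p < u z ^ p := Real.rpow_lt_rpow (mul_nonneg hM0.le (by have := hρ z; positivity))
    hzpos hp
  have hφp : φ z ^ p = M ^ p * ((X z ^ 2 + Y z ^ 2 + ε) ^ (s - 1)) ^ 2 := by
    simp only [φ]
    rw [Real.mul_rpow hM0.le (by have := hρ z; positivity), ← Real.rpow_mul (hρ z).le,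
      ← Real.rpow_mul_natCast (hρ z).le]
    congr 2
    push_cast
    linarith
  have hM2 : M ^ 2 = M ^ p * (36 ^ 2 * t ^ (2 - p)) := by
    have : M ^ (2 - p) = 36 ^ 2 * t ^ (2 - p) := by
      rw [hM, Real.mul_rpow ht.le (by positivity), ← Real.rpow_mul (by norm_num), hsp]
      norm_num [mul_comm]
    rw [← this, ← Real.rpow_add hM0]
    norm_num
  have hr : (X z ^ 2 + Y z ^ 2 + ε) ^ (s - 1) =
      (X z ^ 2 + Y z ^ 2 + ε) ^ (s - 2) * (X z ^ 2 + Y z ^ 2 + ε) := by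
    rw [← Real.rpow_add_one (hρ z).ne']; congr 1; ring
  have hr2 : 0 < (X z ^ 2 + Y z ^ 2 + ε) ^ (s - 2) := Real.rpow_pos_of_pos (hρ z) _
  have hr1 : 0 < (X z ^ 2 + Y z ^ 2 + ε) ^ (s - 1) := Real.rpow_pos_of_pos (hρ z) _
  have hxy : (X z ^ 2 + Y z ^ 2 + ε) ^ (s - 2) * (X z ^ 2 + Y z ^ 2) ≤
      (X z ^ 2 + Y z ^ 2 + ε) ^ (s - 1) := by
    rw [hr]; exact mul_le_mul_of_nonneg_left (by linarith) hr2.le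
  generalize (X z ^ 2 + Y z ^ 2 + ε) ^ (s - 1) = r1 at *
  generalize (X z ^ 2 + Y z ^ 2 + ε) ^ (s - 2) = r2 at *
  have hJ' : 4 * s ^ 2 * (2 * s - 1) * (36 ^ 2 * t ^ (2 - p)) ≤ J ^ 2 := by
    refine le_of_eq_of_le ?_ hJ.le
    rw [triangleConst, ← hs]; ring
  have hDet : (4 * M * s * (s - 1) * r2 * X z ^ 2 + 2 * M * s * r1) *
      (4 * M * s * (s - 1) * r2 * Y z ^ 2 + 2 * M * s * r1) -
      (4 * M * s * (s - 1) * r2 * (X z * Y z)) ^ 2 ≤ M ^ p * r1 ^ 2 * J ^ 2 := by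
    calc _ = 4 * M ^ 2 * s ^ 2 * r1 ^ 2 +
          8 * M ^ 2 * s ^ 2 * (s - 1) * r1 * (r2 * (X z ^ 2 + Y z ^ 2)) := by ring
      _ ≤ 4 * M ^ 2 * s ^ 2 * r1 ^ 2 + 8 * M ^ 2 * s ^ 2 * (s - 1) * r1 * r1 := by
          have : 0 ≤ s - 1 := by linarith
          gcongr
      _ = M ^ p * r1 ^ 2 * (4 * s ^ 2 * (2 * s - 1) * (36 ^ 2 * t ^ (2 - p))) := by
          rw [hM2]; ring
      _ ≤ _ := by gcongr
  have : u z ^ p ≤ M ^ p * r1 ^ 2 := by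
    refine hle.trans ((mul_le_mul_of_nonneg_right hDet (sq_nonneg _)).trans_eq ?_)
    field_simp
  linarith

end IsPositiveConvexSolution

/-! ### Compactness of sublevel sets -/

theorem planeCross_perp_eq_norm_sq (v : EuclideanSpace ℝ (Fin 2)) :
    planeCross v !₂[-v 1, v 0] = ‖v‖ ^ 2 := by
  simp [planeCross, EuclideanSpace.norm_sq_eq, Fin.sum_univ_two]; ring

namespace IsPositiveConvexSolution

variable {p : ℝ} {Ω : Set (EuclideanSpace ℝ (Fin 2))} {u : EuclideanSpace ℝ (Fin 2) → ℝ}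

theorem isClosed_sublevel (hu : IsPositiveConvexSolution p Ω u) (hΩ : IsOpen Ω)
    (hlarge : IsLarge Ω u) (t : ℝ) : IsClosed {x | x ∈ Ω ∧ u x ≤ t} := by
  refine isClosed_of_closure_subset fun z hz => ?_
  have hne : (𝓝[{x | x ∈ Ω ∧ u x ≤ t}] z).NeBot := mem_closure_iff_nhdsWithin_neBot.1 hz
  have hle : 𝓝[{x | x ∈ Ω ∧ u x ≤ t}] z ≤ 𝓝[Ω] z := nhdsWithin_mono _ fun x hx => hx.1
  have hev : ∀ᶠ x in 𝓝[{x | x ∈ Ω ∧ u x ≤ t}] z, u x ≤ t :=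
    eventually_mem_nhdsWithin.mono fun x hx => hx.2
  by_cases hzΩ : z ∈ Ω
  · exact ⟨hzΩ, le_of_tendsto ((hu.contDiffOn.continuousOn z hzΩ).mono_left hle) hev⟩
  · have hfr : z ∈ frontier Ω := by
      rw [hΩ.frontier_eq]
      exact ⟨closure_mono (fun x hx => hx.1) hz, hzΩ⟩
    obtain ⟨x, hx, hx'⟩ := (((hlarge z hfr).mono_left hle).eventually_gt_atTop t |>.and hev).exists
    exact absurd hx' (not_le.2 hx)

/-- A far point y, the centre x₀ of a ball of radius r in the set, and the point at distance r from
x₀ perpendicular to y - x₀ span cross product r‖y - x₀‖, which the area bound controls. -/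
theorem isCompact_sublevel (hu : IsPositiveConvexSolution p Ω u) (hΩ : IsOpen Ω)
    (hlarge : IsLarge Ω u) (hp : 0 < p) (hp2 : p < 2) {t : ℝ} {x₀ : EuclideanSpace ℝ (Fin 2)}
    (hx₀ : {x | x ∈ Ω ∧ u x ≤ t} ∈ 𝓝 x₀) : IsCompact {x | x ∈ Ω ∧ u x ≤ t} := by
  refine Metric.isCompact_of_isClosed_isBounded (hu.isClosed_sublevel hΩ hlarge t) ?_
  obtain ⟨r, hr, hball⟩ := Metric.nhds_basis_closedBall.mem_iff.1 hx₀
  set K := triangleConst p * t ^ (2 - p)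
  refine (Metric.isBounded_closedBall (x := x₀) (r := 1 + K / r ^ 2)).subset fun y hy => ?_
  rw [Metric.mem_closedBall, dist_eq_norm]
  rcases eq_or_ne y x₀ with rfl | hne
  · have hy' := hu.sq_planeCross_le hΩ hp hp2 hy.1 hy.1 hy.1 hy.2 hy.2 hy.2
    have : 0 ≤ K := (sq_nonneg _).trans hy'
    simp; positivity
  have hn : 0 < ‖y - x₀‖ := norm_pos_iff.2 (sub_ne_zero.2 hne)
  set v := y - x₀ with hv
  have hnorm : ‖!₂[-v 1, v 0]‖ = ‖v‖ := by
    rw [← sq_eq_sq₀ (norm_nonneg _) (norm_nonneg _)]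
    simp [EuclideanSpace.norm_sq_eq, Fin.sum_univ_two, add_comm]
  have hR : x₀ + (r / ‖v‖) • !₂[-v 1, v 0] ∈ {x | x ∈ Ω ∧ u x ≤ t} := by
    refine hball ?_
    rw [Metric.mem_closedBall, dist_eq_norm, add_sub_cancel_left, norm_smul, hnorm,
      Real.norm_of_nonneg (by positivity), div_mul_cancel₀ _ hn.ne']
  have h0 := mem_of_mem_nhds hx₀
  have key := hu.sq_planeCross_le hΩ hp hp2 h0.1 hy.1 hR.1 h0.2 hy.2 hR.2
  have hval : planeCross (y - x₀) (x₀ + (r / ‖v‖) • !₂[-v 1, v 0] - x₀) = r * ‖v‖ := by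
    have h1 : planeCross v ((r / ‖v‖) • !₂[-v 1, v 0]) =
        r / ‖v‖ * planeCross v !₂[-v 1, v 0] := by
      simp [planeCross]; ring
    rw [add_sub_cancel_left, ← hv, h1, planeCross_perp_eq_norm_sq]
    field_simp
  rw [hval] at key
  have : ‖v‖ ^ 2 ≤ K / r ^ 2 := by
    rw [le_div_iff₀ (by positivity)]; linarith [mul_pow r ‖v‖ 2]
  nlinarith [sq_nonneg (‖v‖ - 1)]

/-! ### Distance to supporting lines -/

/-- The lower half of a sublevel set stays away from its supporting lines. -/
theorem support_gap (hu : IsPositiveConvexSolution p Ω u) (hΩ : IsOpen Ω)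
    (hlarge : IsLarge Ω u) (hp : 0 < p) (hp2 : p < 2) {t : ℝ} {x₀ : EuclideanSpace ℝ (Fin 2)}
    (hx₀ : {x | x ∈ Ω ∧ u x ≤ t} ∈ 𝓝 x₀) (l : EuclideanSpace ℝ (Fin 2) →L[ℝ] ℝ)
    {P Q : EuclideanSpace ℝ (Fin 2)} (hP : P ∈ Ω) (huP : u P ≤ t) (hQ : Q ∈ Ω) (huQ : u Q ≤ t)
    (hlP : ∀ x ∈ Ω, u x ≤ t → l P ≤ l x) (hlQ : ∀ x ∈ Ω, u x ≤ t → l x ≤ l Q) (hPQ : l P < l Q)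
    {x : EuclideanSpace ℝ (Fin 2)} (hx : x ∈ Ω) (hux : u x ≤ t / 2) :
    l P + 1 / (64 * (2 * triangleConst p + 1)) * (l Q - l P) ≤ l x := by
  have ht : 0 < t := (hu.pos P hP).trans_le huP
  have hS := hu.isCompact_sublevel hΩ hlarge hp hp2 hx₀
  set C := triangleConst p
  have hC0 : 0 < C := triangleConst_pos hp hp2
  -- R is farthest from the line PQ, which gives |Y| ≤ 1 on the sublevel set.
  obtain ⟨R, ⟨hR, huR⟩, hRmax⟩ := hS.exists_isMaxOn ⟨x₀, mem_of_mem_nhds hx₀⟩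
    (f := fun x => |planeCross (Q - P) (x - P)|)
    (by unfold planeCross; fun_prop)
  set J := planeCross (Q - P) (R - P) with hJ
  have hJmax : ∀ y ∈ Ω, u y ≤ t → |planeCross (Q - P) (y - P)| ≤ |J| :=
    fun y hy huy => hRmax (show y ∈ {x | x ∈ Ω ∧ u x ≤ t} from ⟨hy, huy⟩)
  -- Otherwise a neighbourhood of x₀ would lie on the line PQ.
  have hJ0 : J ≠ 0 := by
    intro h0
    set w : EuclideanSpace ℝ (Fin 2) := !₂[-(Q - P) 1, (Q - P) 0]
    have hc : Tendsto (fun r : ℝ => x₀ + r • w) (𝓝[>] 0) (𝓝 x₀) := by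
      have : Continuous fun r : ℝ => x₀ + r • w := by fun_prop
      simpa using (this.tendsto 0).mono_left nhdsWithin_le_nhds
    obtain ⟨r, ⟨hrΩ, hrt⟩, hr⟩ := ((hc.eventually hx₀).and eventually_mem_nhdsWithin).exists
    have hr : 0 < r := hr
    have h1 := hJmax _ hrΩ hrt
    have hx₀' := mem_of_mem_nhds hx₀
    have h2 := hJmax _ hx₀'.1 hx₀'.2
    rw [h0, abs_zero, abs_nonpos_iff] at h1 h2
    have h3 : planeCross (Q - P) (x₀ + r • w - P) =
        planeCross (Q - P) (x₀ - P) + r * planeCross (Q - P) w := by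
      simp [planeCross]; ring
    rw [h1, h2, planeCross_perp_eq_norm_sq] at h3
    have h4 : Q - P ≠ 0 := fun h => by
      rw [sub_eq_zero.1 h] at hPQ; exact lt_irrefl _ hPQ
    have : 0 < ‖Q - P‖ := norm_pos_iff.2 h4
    have : 0 < r * ‖Q - P‖ ^ 2 := by positivity
    linarith
  have hJ2 : J ^ 2 ≤ C * t ^ (2 - p) := hu.sq_planeCross_le hΩ hp hp2 hP hQ hR huP huQ huR
  set a := l Q - l P with ha
  have ha0 : 0 < a := by linarith
  have hl : ∀ e, l e = l (EuclideanSpace.single 0 1) * e 0 +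
      l (EuclideanSpace.single 1 1) * e 1 := by
    intro e
    conv_lhs => rw [euclidean_fin_two_eq e]
    simp only [map_add, map_smul, smul_eq_mul]
    ring
  set l₀ := l (EuclideanSpace.single 0 1)
  set l₁ := l (EuclideanSpace.single 1 1)
  let X : EuclideanSpace ℝ (Fin 2) → ℝ := fun x => (l x - l P) / a
  let Y : EuclideanSpace ℝ (Fin 2) → ℝ := fun x => planeCross (Q - P) (x - P) / J
  have hXc : Continuous X := by unfold X; fun_prop
  have hYc : Continuous Y := by unfold Y planeCross; fun_prop
  have hX : ∀ v e (r : ℝ), X (v + r • e) = X v + r * (l₀ / a * e 0 + l₁ / a * e 1) :=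
    fun v e r => by
      simp only [X, map_add, map_smul, smul_eq_mul, hl e]; ring
  have hY : ∀ v e (r : ℝ), Y (v + r • e) = Y v +
      r * ((-(Q - P) 1 / J) * e 0 + (Q - P) 0 / J * e 1) := fun v e r => by
    simp [Y, planeCross]; ring
  have hdet : (l₀ / a) * ((Q - P) 0 / J) - (l₁ / a) * (-(Q - P) 1 / J) = 1 / J := by
    have h1 : a = l₀ * (Q - P) 0 + l₁ * (Q - P) 1 := by rw [← hl, map_sub]
    rw [show l₀ / a * ((Q - P) 0 / J) - l₁ / a * (-(Q - P) 1 / J) =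
      (l₀ * (Q - P) 0 + l₁ * (Q - P) 1) / a / J by ring, ← h1, div_self ha0.ne']
  have hXnn : ∀ y ∈ Ω, u y ≤ t → 0 ≤ X y ∧ X y ≤ 1 := fun y hy huy =>
    ⟨div_nonneg (sub_nonneg.2 (hlP y hy huy)) ha0.le,
      (div_le_one ha0).2 (by linarith [hlQ y hy huy])⟩
  have hY1 : ∀ y ∈ Ω, u y ≤ t → Y y ^ 2 ≤ 1 := fun y hy huy => by
    rw [sq_le_one_iff_abs_le_one, abs_div]
    exact div_le_one_of_le₀ (hJmax y hy huy) (abs_nonneg _)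
  -- With this choice N²/2 > C, which makes φ a strict subsolution.
  set N := √(2 * C + 1) with hN
  have hN2 : N ^ 2 = 2 * C + 1 := Real.sq_sqrt (by positivity)
  have hN0 : 0 < N := Real.sqrt_pos.2 (by positivity)
  let φ : EuclideanSpace ℝ (Fin 2) → ℝ := fun v => t - t * N * (√(X v) * (4 - Y v ^ 2))
  have hφc : Continuous φ := by unfold φ; fun_prop
  have hφt : ∀ y ∈ Ω, u y ≤ t → φ y ≤ t := fun y hy huy => by
    have : 0 ≤ 4 - Y y ^ 2 := by linarith [hY1 y hy huy]
    have : 0 ≤ t * N * (√(X y) * (4 - Y y ^ 2)) := by positivity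
    simp only [φ]; linarith
  -- Since φ ≤ t, a negative minimum of u - φ lies where u < t, hence in the interior; no boundary
  -- comparison is needed.
  have hcomp : ∀ y ∈ Ω, u y ≤ t → φ y ≤ u y := by
    have huc : ContinuousOn u {x | x ∈ Ω ∧ u x ≤ t} :=
      hu.contDiffOn.continuousOn.mono fun x hx => hx.1
    obtain ⟨z, ⟨hzΩ, hzt⟩, hz⟩ := hS.exists_isMinOn ⟨x₀, mem_of_mem_nhds hx₀⟩
      (huc.sub hφc.continuousOn)
    by_contra! ⟨y, hy, hyt, hlt⟩
    have hzφ : u z < φ z := by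
      have : u z - φ z ≤ u y - φ y := hz (show y ∈ {x | x ∈ Ω ∧ u x ≤ t} from ⟨hy, hyt⟩)
      linarith
    have hzlt : u z < t := hzφ.trans_le (hφt z hzΩ hzt)
    have hnhds : {x | x ∈ Ω ∧ u x ≤ t} ∈ 𝓝 z := by
      have hcz : ContinuousAt u z :=
        (hu.contDiffOn.continuousOn z hzΩ).continuousAt (hΩ.mem_nhds hzΩ)
      filter_upwards [hΩ.mem_nhds hzΩ, hcz.eventually_lt_const hzlt] with v hv hvt
      exact ⟨hv, hvt.le⟩
    have hXz : 0 < X z := by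
      refine lt_of_le_of_ne (hXnn z hzΩ hzt).1 fun h0 => ?_
      have hc : Tendsto (fun r : ℝ => z + r • (P - Q)) (𝓝[>] 0) (𝓝 z) := by
        have : Continuous fun r : ℝ => z + r • (P - Q) := by fun_prop
        simpa using (this.tendsto 0).mono_left nhdsWithin_le_nhds
      obtain ⟨r, ⟨hrΩ, hrt⟩, hr⟩ := ((hc.eventually hnhds).and eventually_mem_nhdsWithin).exists
      have hr : 0 < r := hr
      have h1 := hlP _ hrΩ hrt
      have h2 : l z = l P := by
        have := h0.symm
        simp only [X, div_eq_zero_iff, ha0.ne', or_false] at this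
        linarith
      simp only [map_add, map_smul, map_sub, smul_eq_mul, h2] at h1
      nlinarith
    have hYz := hY1 z hzΩ hzt
    have hsq : √(X z) ^ 2 = X z := Real.sq_sqrt hXz.le
    have hsq0 : 0 < √(X z) := Real.sqrt_pos.2 hXz
    have hDval : t * N * (4 - Y z ^ 2) / (4 * X z * √(X z)) * (2 * (t * N) * √(X z)) -
        (t * N * Y z / √(X z)) ^ 2 = t ^ 2 * N ^ 2 * ((2 - 3 / 2 * Y z ^ 2) / X z) := by
      generalize Y z = y at *
      rw [div_pow (t * N * y), hsq]
      field_simp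
      ring
    have hDge : t ^ 2 * N ^ 2 * (1 / 2) ≤ t ^ 2 * N ^ 2 * ((2 - 3 / 2 * Y z ^ 2) / X z) := by
      have : 1 / 2 ≤ (2 - 3 / 2 * Y z ^ 2) / X z := by
        rw [le_div_iff₀ hXz]
        linarith [(hXnn z hzΩ hzt).2]
      exact mul_le_mul_of_nonneg_left this (by positivity)
    have hge := hu.le_rpow_of_isLocalMin_sub hΩ hzΩ (hz.isLocalMin hnhds)
      (hasSymmSndDeriv_sqrt_barrier hX hY t (t * N) hXz)
      (by have : 0 < 4 - Y z ^ 2 := by linarith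
          positivity)
      (by rw [hDval]; exact le_trans (by positivity) hDge)
    rw [hDval, hdet] at hge
    have h1 : u z ^ p ≤ t ^ p := Real.rpow_le_rpow (hu.pos z hzΩ).le hzt hp.le
    have h2 : t ^ 2 * N ^ 2 * (1 / 2) * (1 / J) ^ 2 ≤ t ^ p :=
      (mul_le_mul_of_nonneg_right hDge (sq_nonneg _)).trans (hge.trans h1)
    have hJpos : 0 < J ^ 2 := by positivity
    have h3 : t ^ 2 * N ^ 2 * (1 / 2) ≤ t ^ p * J ^ 2 := by
      rwa [div_pow, one_pow, mul_one_div, div_le_iff₀ hJpos] at h2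
    have h4 : t ^ p * t ^ (2 - p) = t ^ 2 := by
      rw [← Real.rpow_add ht]; norm_num
    have h5 : t ^ p * J ^ 2 ≤ C * t ^ 2 := by
      calc t ^ p * J ^ 2 ≤ t ^ p * (C * t ^ (2 - p)) := by gcongr
        _ = C * (t ^ p * t ^ (2 - p)) := by ring
        _ = C * t ^ 2 := by rw [h4]
    rw [hN2] at h3
    have : 0 < t ^ 2 := by positivity
    nlinarith
  have hxt : u x ≤ t := by linarith
  have h1 := hcomp x hx hxt
  have hYx := hY1 x hx hxt
  -- From t - 4tN√X ≤ φ ≤ u ≤ t/2; squaring gives X ≥ 1/(64N²).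
  have h2 : 1 / 2 ≤ 4 * N * √(X x) := by
    have h3 : t * N * (√(X x) * (4 - Y x ^ 2)) ≤ t * N * (√(X x) * 4) := by
      gcongr; linarith [sq_nonneg (Y x)]
    have h4 : t * (1 / 2) ≤ t * (4 * N * √(X x)) := by
      simp only [φ] at h1; linarith
    exact le_of_mul_le_mul_left h4 ht
  have h3 : (1 / 2) ^ 2 ≤ 16 * (2 * C + 1) * X x := by
    calc (1 / 2 : ℝ) ^ 2 ≤ (4 * N * √(X x)) ^ 2 := by gcongr
      _ = 16 * N ^ 2 * √(X x) ^ 2 := by ring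
      _ = _ := by rw [hN2, Real.sq_sqrt (hXnn x hx hxt).1]
  have h4 : 1 / (64 * (2 * C + 1)) ≤ X x := by
    rw [div_le_iff₀ (by positivity)]; linarith
  have := (le_div_iff₀ ha0).1 h4
  linarith

end IsPositiveConvexSolution

/-! ### Iteration over doubled levels -/

theorem IsPositiveConvexSolution.not_isLarge {p : ℝ} (hp : 0 < p) (hp2 : p < 2)
    {Ω : Set (EuclideanSpace ℝ (Fin 2))} (hΩ : IsOpen Ω) (hconv : Convex ℝ Ω)
    (hne : Ω.Nonempty) (huniv : Ω ≠ univ) {u : EuclideanSpace ℝ (Fin 2) → ℝ}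
    (hu : IsPositiveConvexSolution p Ω u) : ¬ IsLarge Ω u := by
  intro hlarge
  obtain ⟨x₀, hx₀⟩ := hne
  obtain ⟨z, hz⟩ := (ne_univ_iff_exists_notMem Ω).1 huniv
  obtain ⟨l, hl⟩ := geometric_hahn_banach_point_open hconv hΩ hz
  -- The extra 1 puts x₀ in the interior of every sublevel set used.
  set t₀ := u x₀ + 1
  have ht₀ : 0 < t₀ := by have := hu.pos x₀ hx₀; positivity
  have hnhds : ∀ t, t₀ ≤ t → {x | x ∈ Ω ∧ u x ≤ t} ∈ 𝓝 x₀ := fun t ht => by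
    have hcz : ContinuousAt u x₀ :=
      (hu.contDiffOn.continuousOn x₀ hx₀).continuousAt (hΩ.mem_nhds hx₀)
    filter_upwards [hΩ.mem_nhds hx₀, hcz.eventually_lt_const (lt_add_one (u x₀))] with v hv hvt
    exact ⟨hv, hvt.le.trans ht⟩
  -- l(x₁) - l(x₀) bounds the width of all later sublevel sets from below.
  obtain ⟨x₁, hx₁, hux₁, hlt⟩ : ∃ x₁ ∈ Ω, u x₁ ≤ t₀ ∧ l x₀ < l x₁ := by
    have hc : Tendsto (fun r : ℝ => x₀ + r • (x₀ - z)) (𝓝[>] 0) (𝓝 x₀) := by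
      have : Continuous fun r : ℝ => x₀ + r • (x₀ - z) := by fun_prop
      simpa using (this.tendsto 0).mono_left nhdsWithin_le_nhds
    obtain ⟨r, ⟨hrΩ, hrt⟩, hr⟩ :=
      ((hc.eventually (hnhds t₀ le_rfl)).and eventually_mem_nhdsWithin).exists
    have hr : 0 < r := hr
    refine ⟨_, hrΩ, hrt, ?_⟩
    simp only [map_add, map_smul, map_sub, smul_eq_mul]
    have := hl x₀ hx₀
    nlinarith
  set δ := 1 / (64 * (2 * triangleConst p + 1))
  have hδ0 : 0 < δ := by
    have := triangleConst_pos hp hp2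
    positivity
  have hpow : ∀ k : ℕ, t₀ ≤ 2 ^ k * t₀ := fun k => by
    nlinarith [one_le_pow₀ (one_le_two : (1 : ℝ) ≤ 2) (n := k)]
  have main : ∀ k : ℕ, ∃ P ∈ Ω, u P ≤ 2 ^ k * t₀ ∧ l P ≤ l x₀ - k * (δ * (l x₁ - l x₀)) := by
    intro k
    induction k with
    | zero => exact ⟨x₀, hx₀, by simp [t₀], by simp⟩
    | succ k ih =>
      obtain ⟨P, hP, huP, hlP⟩ := ih
      have hn := hnhds _ (hpow (k + 1))
      have hS := hu.isCompact_sublevel hΩ hlarge hp hp2 hn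
      obtain ⟨P', ⟨hP', huP'⟩, hmin⟩ := hS.exists_isMinOn ⟨x₀, mem_of_mem_nhds hn⟩
        l.continuous.continuousOn
      obtain ⟨Q', ⟨hQ', huQ'⟩, hmax⟩ := hS.exists_isMaxOn ⟨x₀, mem_of_mem_nhds hn⟩
        l.continuous.continuousOn
      have h1 : l P' ≤ l x₀ := hmin (mem_of_mem_nhds hn)
      have h2 : l x₁ ≤ l Q' :=
        hmax (show x₁ ∈ {x | x ∈ Ω ∧ u x ≤ _} from ⟨hx₁, hux₁.trans (hpow (k + 1))⟩)
      -- The old P lies at no more than half of the new level, so the new minimum is lower by the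
      -- gap.
      have h3 := hu.support_gap hΩ hlarge hp hp2 hn l hP' huP' hQ' huQ'
        (fun x hx hxt => hmin (show x ∈ {x | x ∈ Ω ∧ u x ≤ _} from ⟨hx, hxt⟩))
        (fun x hx hxt => hmax (show x ∈ {x | x ∈ Ω ∧ u x ≤ _} from ⟨hx, hxt⟩))
        (by linarith) hP (by rw [pow_succ]; linarith)
      have h4 : δ * (l x₁ - l x₀) ≤ δ * (l Q' - l P') := by gcongr
      refine ⟨P', hP', huP', ?_⟩
      push_cast
      linarith
  have hpos : 0 < δ * (l x₁ - l x₀) := mul_pos hδ0 (by linarith)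
  obtain ⟨k, hk⟩ := exists_nat_gt ((l x₀ - l z) / (δ * (l x₁ - l x₀)))
  obtain ⟨P, hP, -, hlP⟩ := main k
  have := hl P hP
  rw [div_lt_iff₀ hpos] at hk
  linarith

theorem theorem7p1 (p : ℝ) (hp_pos : 0 < p) (hp_lt : p < 1 / 2)
    (Ω : Set (EuclideanSpace ℝ (Fin 2))) (hΩ_open : IsOpen Ω) (hΩ_convex : Convex ℝ Ω)
    (hΩ_unbounded : ¬ Bornology.IsBounded Ω) (hΩ_ne : Ω ≠ univ) :
    ¬ ∃ u : EuclideanSpace ℝ (Fin 2) → ℝ,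
      IsPositiveConvexSolution p Ω u ∧ IsEuclideanComplete Ω u := by
  rintro ⟨u, hu, huniv | ⟨-, hlarge⟩⟩
  · exact hΩ_ne huniv
  · have hne : Ω.Nonempty := by
      rw [nonempty_iff_ne_empty]
      rintro rfl
      exact hΩ_unbounded Bornology.isBounded_empty
    exact hu.not_isLarge hp_pos (by linarith) hΩ_open hΩ_convex hne hΩ_ne hlarge
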